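/- Let $M$ be a smooth ($C^\infty$, Hausdorff) manifold. A bivector field $\Lambda$ on $M$ is identified with the skew-symmetric $C^\infty(M)$-linear map $\Lambda:\Omega^1(M)\to\chi(M)$, $\langle\beta,\Lambda\alpha\rangle=\Lambda(\alpha,\beta)$. A pair $(\Lambda,E)$ of a bivector field and a vector field is a Jacobi structure if $[E,\Lambda]=0$ and $[\Lambda,\Lambda]=2E\wedge\Lambda$, where the Schouten--Nijenhuis bracket is normalised by $\tfrac12[\Lambda,\Lambda](\alpha,\beta,\gamma)=\langle\gamma,\Lambda\{\alpha,\beta\}_\Lambda-[\Lambda\alpha,\Lambda\beta]\rangle$ with $\{\alpha,\beta\}_\Lambda=L_{\Lambda\alpha}\beta-L_{\Lambda\beta}\alpha-d(\Lambda(\alpha,\beta))$; its bracket on $C^\infty(M,\mathbb R)$ is $\{f,g\}=\Lambda(df,dg)+\langle f\,dg-g\,df,E\rangle$. A Jacobi bracket is an $\mathbb R$-bilinear, skew-symmetric bracket on $C^\infty(M,\mathbb R)$ that satisfies the Jacobi identity and is local, i.e. $\operatorname{supp}\{f,g\}\subseteq\operatorname{supp}f\cap\operatorname{supp}g$. Two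 Jacobi structures form a Jacobi pencil (are compatible) if $\{\cdot,\cdot\}_1-\lambda\{\cdot,\cdot\}_2$ is a Jacobi bracket for every $\lambda\in\mathbb R$. For a $(1,1)$-tensor field $J$ let $N_J(X,Y)=[JX,JY]-J[JX,Y]-J[X,JY]+J^2[X,Y]$; $J$ is a Nijenhuis tensor if $N_J=0$. If $J\circ\Lambda=\Lambda\circ{}^tJ$, let $J\Lambda$ be the bivector field $J\circ\Lambda$ (so $J^k\Lambda=J^k\circ\Lambda$) and put $$C(\Lambda,J)(\alpha,\beta)=\{\alpha,\beta\}_{J\Lambda}-\big(\{{}^tJ\alpha,\beta\}_\Lambda+\{\alpha,{}^tJ\beta\}_\Lambda-{}^tJ\{\alpha,\beta\}_\Lambda\big).$$ $J$ is compatible with the Jacobi structure $(\Lambda,E)$ if $N_J(\Lambda\alpha,\Lambda\beta)=0$ and $N_J(\Lambda\alpha,J^kE)=0$ for all $\alpha,\beta\in\Omega^1(M)$ and all integers $k\ge0$, and (i) $J\circ\Lambda=\Lambda\circ{}^tJ$; (ii) $\big\langle{}^tJ\gamma,\ \Lambda\big(C(\Lambda,J)(\alpha,\beta)\big)-\Lambda(\alpha,\beta)JE+\Lambda(\alpha,{}^tJ\beta)E\big\rangle=0$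 for all $\alpha,\beta,\gamma\in\Omega^1(M)$; (iii) $[J^kE,\Lambda]+[E,J^k\Lambda]=0$ for every integer $k\ge1$. **Theorem.** Let $(\Lambda,E)$ be a Jacobi structure on $M$ that is compatible with a Nijenhuis tensor $J$. Then for every integer $k\ge1$ the pair $(J^k\Lambda,J^kE)$ is a Jacobi structure on $M$. Moreover, for all integers $k_1,k_2\ge1$, the Jacobi structures $(J^{k_1}\Lambda,J^{k_1}E)$ and $(J^{k_2}\Lambda,J^{k_2}E)$ form a Jacobi pencil. -/

import Mathlib

open scoped Manifold ContDiff

noncomputable section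

namespace JacobiGeometry

/-! All objects live on a smooth (`C^∞`) manifold `M` of dimension `n` without boundary. -/

/-- The ring `C^∞(M, ℝ)`. -/
abbrev SmoothFun (n : ℕ) (M : Type*) [TopologicalSpace M]
    [ChartedSpace (EuclideanSpace ℝ (Fin n)) M] : Type _ :=
  C^∞⟮𝓡 n, M; ℝ⟯

/-- The space `χ(M)` of smooth vector fields: smooth sections of the tangent bundle. -/
abbrev VectField (n : ℕ) (M : Type*) [TopologicalSpace M]
    [ChartedSpace (EuclideanSpace ℝ (Fin n)) M] [IsManifold (𝓡 n) ∞ M] : Type _ :=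
  Cₛ^∞⟮𝓡 n; EuclideanSpace ℝ (Fin n), (TangentSpace (𝓡 n) : M → Type _)⟯

section Basic

variable {n : ℕ} {M : Type*} [TopologicalSpace M]
  [ChartedSpace (EuclideanSpace ℝ (Fin n)) M] [IsManifold (𝓡 n) ∞ M]

/-- Pointwise multiplication of a vector field by a smooth function. -/
instance instSMulVectField : SMul (SmoothFun n M) (VectField n M) :=
  ⟨fun f X => ⟨fun x => f x • X x, f.contMDiff.smul_section X.contMDiff⟩⟩

@[simp]
theorem smul_vectField_apply (f : SmoothFun n M) (X : VectField n M) (x : M) :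
    (f • X) x = f x • X x := rfl

/-- `χ(M)` is a module over `C^∞(M, ℝ)`. -/
instance instModuleVectField : Module (SmoothFun n M) (VectField n M) where
  one_smul X := by ext x; exact one_smul ℝ (X x)
  mul_smul f g X := by ext x; exact mul_smul (f x) (g x) (X x)
  smul_zero f := by ext x; exact smul_zero (f x)
  smul_add f X Y := by ext x; exact smul_add (f x) (X x) (Y x)
  add_smul f g X := by ext x; exact add_smul (f x) (g x) (X x)
  zero_smul X := by ext x; exact zero_smul ℝ (X x)

theorem mdiffAt_vectField (X : VectField n M) (x : M) :
    MDifferentiableAt (𝓡 n) ((𝓡 n).prod 𝓘(ℝ, EuclideanSpace ℝ (Fin n)))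
      (fun y => (⟨y, X y⟩ : TangentBundle (𝓡 n) M)) x :=
  (X.contMDiff x).mdifferentiableAt (by simp)

theorem mdiffAt_fun (f : SmoothFun n M) (x : M) :
    MDifferentiableAt (𝓡 n) 𝓘(ℝ) f x :=
  (f.contMDiff x).mdifferentiableAt (by simp)

theorem contMDiff_deriv (X : VectField n M) (f : SmoothFun n M) :
    ContMDiff (𝓡 n) 𝓘(ℝ) ∞ (fun x => mvfderiv (𝓡 n) f x (X x)) := by
  have h1 : ContMDiff (𝓡 n) (𝓘(ℝ).prod 𝓘(ℝ)) ∞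
      (fun x => tangentMap (𝓡 n) 𝓘(ℝ) f ⟨x, X x⟩) :=
    (f.contMDiff.contMDiff_tangentMap (m := ∞) (by simp)).comp X.contMDiff
  exact (contMDiff_snd_tangentBundle_modelSpace ℝ 𝓘(ℝ) (n := ∞)).comp h1

/-- The derivative `X f = df(X)` of a smooth function along a vector field. -/
def act (X : VectField n M) (f : SmoothFun n M) : SmoothFun n M :=
  ⟨fun x => mvfderiv (𝓡 n) f x (X x), contMDiff_deriv X f⟩

theorem act_add (X : VectField n M) (f g : SmoothFun n M) :
    act X (f + g) = act X f + act X g := by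
  ext x
  exact congrArg (fun L => L (X x)) (mvfderiv_add (mdiffAt_fun f x) (mdiffAt_fun g x))

theorem act_mul (X : VectField n M) (f g : SmoothFun n M) :
    act X (f * g) = f * act X g + g * act X f := by
  ext x
  have h := congrArg (fun L => L (X x)) (mvfderiv_mul (mdiffAt_fun f x) (mdiffAt_fun g x))
  exact h

/-- The Lie bracket `[X, Y]` of vector fields. -/
def lie (X Y : VectField n M) : VectField n M :=
  ⟨VectorField.mlieBracket (𝓡 n) X Y, by
    have : IsManifold (𝓡 n) (((⊤ : ℕ∞) : WithTop ℕ∞) + 1) M := by simpa using ‹_›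
    have : IsManifold (𝓡 n) (minSmoothness ℝ 2) M := by
      rw [minSmoothness_of_isRCLikeNormedField]
      infer_instance
    exact ContDiff.mlieBracket_vectorField (n := ⊤) (m := ⊤) X.contMDiff Y.contMDiff (by simp)⟩

theorem lie_add (X Y Z : VectField n M) : lie X (Y + Z) = lie X Y + lie X Z := by
  ext x
  exact VectorField.mlieBracket_add_right (mdiffAt_vectField Y x) (mdiffAt_vectField Z x)

theorem lie_smul (X Y : VectField n M) (f : SmoothFun n M) :
    lie X (f • Y) = act X f • Y + f • lie X Y := by
  ext x
  exact VectorField.mlieBracket_smul_right (mdiffAt_fun f x) (mdiffAt_vectField Y x)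

end Basic

/-- The space `Ω¹(M)` of smooth differential 1-forms, as the `C^∞(M, ℝ)`-linear maps
`χ(M) → C^∞(M, ℝ)`; `⟨α, X⟩` is `α X`. By the tensoriality lemma (bump functions and local
frames), on a Hausdorff manifold these are the smooth sections of the cotangent bundle, and
likewise for the tensor fields below. -/
abbrev OneForm (n : ℕ) (M : Type*) [TopologicalSpace M]
    [ChartedSpace (EuclideanSpace ℝ (Fin n)) M] [IsManifold (𝓡 n) ∞ M] : Type _ :=
  Module.Dual (SmoothFun n M) (VectField n M)

/-- `(1,1)`-tensor fields, as the `C^∞(M, ℝ)`-linear maps `χ(M) → χ(M)`. -/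
abbrev Tensor11 (n : ℕ) (M : Type*) [TopologicalSpace M]
    [ChartedSpace (EuclideanSpace ℝ (Fin n)) M] [IsManifold (𝓡 n) ∞ M] : Type _ :=
  Module.End (SmoothFun n M) (VectField n M)

/-- The `C^∞(M, ℝ)`-linear maps `Ω¹(M) → χ(M)`. The bivector fields are those that are
skew-symmetric, see `IsBivector`. -/
abbrev SharpMap (n : ℕ) (M : Type*) [TopologicalSpace M]
    [ChartedSpace (EuclideanSpace ℝ (Fin n)) M] [IsManifold (𝓡 n) ∞ M] : Type _ :=
  OneForm n M →ₗ[SmoothFun n M] VectField n M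

section Tensors

variable {n : ℕ} {M : Type*} [TopologicalSpace M]
  [ChartedSpace (EuclideanSpace ℝ (Fin n)) M] [IsManifold (𝓡 n) ∞ M]

/-- The differential `df` of a smooth function. -/
def diff (f : SmoothFun n M) : OneForm n M where
  toFun X := act X f
  map_add' X Y := by
    ext x
    exact map_add (mvfderiv (𝓡 n) f x) (X x) (Y x)
  map_smul' g X := by
    ext x
    exact map_smul (mvfderiv (𝓡 n) f x) (g x) (X x)

/-- The Lie derivative `L_X β` of a 1-form: `⟨L_X β, Y⟩ = X⟨β, Y⟩ - ⟨β, [X, Y]⟩`. -/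
def lieForm (X : VectField n M) (β : OneForm n M) : OneForm n M where
  toFun Y := act X (β Y) - β (lie X Y)
  map_add' Y Z := by
    rw [map_add, act_add, lie_add, map_add]
    ring
  map_smul' f Y := by
    rw [map_smul, lie_smul, map_add, map_smul, map_smul, smul_eq_mul, act_mul]
    simp only [smul_eq_mul, RingHom.id_apply]
    ring

/-- The transpose `ᵗJ` acting on 1-forms, `⟨ᵗJ α, X⟩ = ⟨α, J X⟩`. -/
def transp (J : Tensor11 n M) : Module.End (SmoothFun n M) (OneForm n M) :=
  Module.Dual.transpose J

/-- `Λ(α, β) = ⟨β, Λ α⟩`. -/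
def pair (Λ : SharpMap n M) (α β : OneForm n M) : SmoothFun n M := β (Λ α)

/-- `Λ` is (the map associated with) a bivector field. -/
def IsBivector (Λ : SharpMap n M) : Prop :=
  ∀ α β : OneForm n M, α (Λ β) + β (Λ α) = 0

/-- The bracket `{α, β}_Λ = L_{Λα} β - L_{Λβ} α - d(Λ(α, β))` of 1-forms. -/
def formBracket (Λ : SharpMap n M) (α β : OneForm n M) : OneForm n M :=
  lieForm (Λ α) β - lieForm (Λ β) α - diff (pair Λ α β)

/-- The Schouten-Nijenhuis bracket `[P, Q]` of two bivector fields, evaluated on 1-forms. The sign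
is the one of Lichnerowicz: on exact forms, with `{f, g}_P = P(df, dg)`, this is
`[P, Q](df, dg, dh) = -∑ ({f, {g, h}_Q}_P + {f, {g, h}_P}_Q)`, the sum being over the cyclic
permutations of `f, g, h`. -/
def schouten (P Q : SharpMap n M) (α β γ : OneForm n M) : SmoothFun n M :=
  γ (P (formBracket Q α β) + Q (formBracket P α β) - lie (P α) (Q β) - lie (Q α) (P β))

/-- The Schouten-Nijenhuis bracket `[X, Λ] = L_X Λ` of a vector field and a bivector field,
evaluated on 1-forms. -/
def lieBivector (X : VectField n M) (Λ : SharpMap n M) (α β : OneForm n M) : SmoothFun n M :=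
  act X (pair Λ α β) - pair Λ (lieForm X α) β - pair Λ α (lieForm X β)

/-- The exterior product `X ∧ Λ` of a vector field and a bivector field, evaluated on 1-forms. -/
def wedge (X : VectField n M) (Λ : SharpMap n M) (α β γ : OneForm n M) : SmoothFun n M :=
  α X * pair Λ β γ + β X * pair Λ γ α + γ X * pair Λ α β

/-- `(Λ, E)` is a Jacobi structure: `Λ` is a bivector field, `[E, Λ] = 0` and
`[Λ, Λ] = 2 E ∧ Λ`. -/
structure IsJacobiStructure (Λ : SharpMap n M) (E : VectField n M) : Prop where
  bivector : IsBivector Λ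
  lie_eq_zero : ∀ α β : OneForm n M, lieBivector E Λ α β = 0
  schouten_eq : ∀ α β γ : OneForm n M, schouten Λ Λ α β γ = 2 * wedge E Λ α β γ

/-- The bracket `{f, g} = Λ(df, dg) + ⟨f dg - g df, E⟩` of the pair `(Λ, E)`. -/
def jacobiBracket (Λ : SharpMap n M) (E : VectField n M) (f g : SmoothFun n M) : SmoothFun n M :=
  pair Λ (diff f) (diff g) + (f • diff g - g • diff f) E

/-- Jacobi brackets on `C^∞(M, ℝ)`: `ℝ`-bilinear, skew-symmetric and local brackets that satisfy
the Jacobi identity. -/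
structure IsJacobiBracket (B : SmoothFun n M → SmoothFun n M → SmoothFun n M) : Prop where
  add_left : ∀ f g h, B (f + g) h = B f h + B g h
  smul_left : ∀ (c : ℝ) (f h), B (c • f) h = c • B f h
  skew : ∀ f g, B f g = -B g f
  jacobi : ∀ f g h, B f (B g h) + B g (B h f) + B h (B f g) = 0
  isLocal : ∀ f g, tsupport (B f g) ⊆ tsupport f ∩ tsupport g

/-- Two Jacobi structures define a Jacobi pencil (are compatible) if `{ , }₁ - lam { , }₂` is a
Jacobi bracket for every real `lam`. -/
structure IsJacobiPencil (Λ₁ : SharpMap n M) (E₁ : VectField n M)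
    (Λ₂ : SharpMap n M) (E₂ : VectField n M) : Prop where
  jacobi_fst : IsJacobiStructure Λ₁ E₁
  jacobi_snd : IsJacobiStructure Λ₂ E₂
  pencil : ∀ lam : ℝ, IsJacobiBracket
    (fun f g => jacobiBracket Λ₁ E₁ f g - lam • jacobiBracket Λ₂ E₂ f g)

/-- The Nijenhuis torsion `N_J(X, Y) = [JX, JY] - J[JX, Y] - J[X, JY] + J²[X, Y]`. -/
def torsion (J : Tensor11 n M) (X Y : VectField n M) : VectField n M :=
  lie (J X) (J Y) - J (lie (J X) Y) - J (lie X (J Y)) + J (J (lie X Y))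

/-- `J` is a Nijenhuis tensor: its Nijenhuis torsion vanishes. -/
def IsNijenhuis (J : Tensor11 n M) : Prop :=
  ∀ X Y : VectField n M, torsion J X Y = 0

/-- `C(Λ, J)(α, β) = {α, β}_{JΛ} - ({ᵗJα, β}_Λ + {α, ᵗJβ}_Λ - ᵗJ{α, β}_Λ)`. -/
def concomitant (Λ : SharpMap n M) (J : Tensor11 n M) (α β : OneForm n M) : OneForm n M :=
  formBracket (J ∘ₗ Λ) α β -
    (formBracket Λ (transp J α) β + formBracket Λ α (transp J β)
      - transp J (formBracket Λ α β))

/-- Compatibility of the `(1,1)`-tensor field `J` with the Jacobi structure `(Λ, E)`. -/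
structure IsCompatible (Λ : SharpMap n M) (E : VectField n M) (J : Tensor11 n M) : Prop where
  torsion_sharp : ∀ α β : OneForm n M, torsion J (Λ α) (Λ β) = 0
  torsion_field : ∀ (α : OneForm n M) (k : ℕ), torsion J (Λ α) ((J ^ k) E) = 0
  comm : J ∘ₗ Λ = Λ ∘ₗ transp J
  concomitant_eq : ∀ α β γ : OneForm n M,
    (transp J γ) (Λ (concomitant Λ J α β) - pair Λ α β • J E + pair Λ α (transp J β) • E) = 0
  lie_eq : ∀ k : ℕ, 1 ≤ k → ∀ α β : OneForm n M,
    lieBivector ((J ^ k) E) Λ α β + lieBivector E ((J ^ k) ∘ₗ Λ) α β = 0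

end Tensors

end JacobiGeometry

end

/-! Both claims are cases of one polarised statement: for all `j, k ≥ 1`, `[J^j Λ, J^k Λ] = J^j E ∧
J^k Λ + J^k E ∧ J^j Λ` and `[J^j E, J^k Λ] + [J^k E, J^j Λ] = 0`. The diagonal `j = k` gives the
Jacobi structures. For `j ≠ k` these are the cross terms in the expansion of the equations for `(P -
c Q, E - c F)`, so this pair is again a Jacobi structure, and its bracket is the required
combination.

The Schouten relation is proved by induction on `(j, k)`. Two identities move `J` through the
bracket: `schouten_comp_comp` raises both indices, and `schouten_comp_add` gives the sum over
raising either one. The error terms are concomitants. `concomitant_pow` reduces those of `J^k Λ` to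
those of `Λ`, which condition (ii) evaluates, but only against forms `ᵗJ γ`. Hence the induction
carries `HierarchyRelation`, contracted with `ᵗJ γ`; raising both indices
(`HierarchyRelation.schouten_succ`) removes the contraction, which is why the final relation needs
`j, k ≥ 1`. The Lie derivative relation follows from `lieBivector_pow` and condition (iii). -/

namespace JacobiGeometry

noncomputable section

/-! ### Derivations and the Lie bracket of vector fields. -/

section Calculus

variable {n : ℕ} {M : Type*} [TopologicalSpace M]
  [ChartedSpace (EuclideanSpace ℝ (Fin n)) M] [IsManifold (𝓡 n) ∞ M]

theorem act_apply (X : VectField n M) (f : SmoothFun n M) (x : M) :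
    act X f x = mvfderiv (𝓡 n) f x (X x) := rfl

theorem smul_act (g : SmoothFun n M) (X : VectField n M) (f : SmoothFun n M) :
    act (g • X) f = g * act X f :=
  map_smul (diff f) g X

theorem sub_act (X Y : VectField n M) (f : SmoothFun n M) :
    act (X - Y) f = act X f - act Y f :=
  map_sub (diff f) X Y

/-- The derivation `act X` as an additive homomorphism. -/
def actHom (X : VectField n M) : SmoothFun n M →+ SmoothFun n M :=
  AddMonoidHom.mk' (act X) (act_add X)

theorem act_neg (X : VectField n M) (f : SmoothFun n M) : act X (-f) = -act X f :=
  map_neg (actHom X) f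

theorem act_sub (X : VectField n M) (f g : SmoothFun n M) :
    act X (f - g) = act X f - act X g :=
  map_sub (actHom X) f g

theorem act_algebraMap (X : VectField n M) (c : ℝ) :
    act X (algebraMap ℝ (SmoothFun n M) c) = 0 := by
  ext x
  exact congrArg (fun L => L (X x)) (mvfderiv_const (I := 𝓡 n) (M := M) c (x := x))

theorem lie_swap (X Y : VectField n M) : lie X Y = -lie Y X := by
  ext x
  exact VectorField.mlieBracket_swap_apply

/-- The map `lie X` as an additive homomorphism. -/
def lieHom (X : VectField n M) : VectField n M →+ VectField n M :=
  AddMonoidHom.mk' (lie X) (lie_add X)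

theorem lie_sub (X Y Z : VectField n M) : lie X (Y - Z) = lie X Y - lie X Z :=
  map_sub (lieHom X) Y Z

theorem sub_lie (X Y Z : VectField n M) : lie (X - Y) Z = lie X Z - lie Y Z := by
  rw [lie_swap, lie_sub, lie_swap Z X, lie_swap Z Y]
  abel

theorem smul_lie (f : SmoothFun n M) (X Y : VectField n M) :
    lie (f • X) Y = f • lie X Y - act Y f • X := by
  rw [lie_swap, lie_smul, lie_swap Y X]
  module

theorem lie_lie (X Y Z : VectField n M) :
    lie X (lie Y Z) = lie (lie X Y) Z + lie Y (lie X Z) := by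
  have h2 : minSmoothness ℝ 2 ≤ ∞ := by
    rw [minSmoothness_of_isRCLikeNormedField]
    exact ENat.LEInfty.out
  have : IsManifold (𝓡 n) (minSmoothness ℝ 3) M := by
    rw [minSmoothness_of_isRCLikeNormedField]
    exact IsManifold.of_le (n := ∞) ENat.LEInfty.out
  ext x
  exact VectorField.leibniz_identity_mlieBracket_apply
    ((X.contMDiff x).of_le h2) ((Y.contMDiff x).of_le h2) ((Z.contMDiff x).of_le h2)

/-- Expand the Jacobi identity for `X`, `Y`, `f • Z` by the Leibniz rule; everything cancels except
the multiples of `Z`. -/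
theorem act_lie_smul (X Y : VectField n M) (f : SmoothFun n M) (Z : VectField n M) :
    act (lie X Y) f • Z = (act X (act Y f) - act Y (act X f)) • Z := by
  have h := lie_lie X Y (f • Z)
  simp only [lie_smul, lie_add, lie_lie X Y Z, smul_add] at h
  rw [← sub_eq_zero] at h ⊢
  rw [← neg_eq_zero, ← h]
  module

theorem lie_apply_eq_zero {X Y : VectField n M} {x : M} (hX : X x = 0) (hY : Y x = 0) :
    lie X Y x = 0 :=
  VectorField.mlieBracketWithin_eq_zero_of_eq_zero hX hY

/-- Pointwise, `act_lie_smul` can be cancelled once some field `Z` is nonzero at `x`. `X` or `Y`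
itself serves, and where both vanish so do both sides. -/
theorem act_lie (X Y : VectField n M) (f : SmoothFun n M) :
    act (lie X Y) f = act X (act Y f) - act Y (act X f) := by
  ext x
  have key (Z : VectField n M) (hZ : Z x ≠ 0) :
      act (lie X Y) f x = (act X (act Y f) - act Y (act X f)) x := by
    have h : act (lie X Y) f x • Z x = (act X (act Y f) - act Y (act X f)) x • Z x :=
      congrArg (fun W : VectField n M => W x) (act_lie_smul X Y f Z)
    exact smul_left_injective ℝ hZ h
  by_cases hX : X x = 0
  · by_cases hY : Y x = 0
    · have h : (act X (act Y f) - act Y (act X f)) x = act X (act Y f) x - act Y (act X f) x := rfl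
      rw [h, act_apply, act_apply, act_apply, hX, hY, lie_apply_eq_zero hX hY]
      simp
    · exact key Y hY
  · exact key X hX

theorem act_apply_eq_zero {X : VectField n M} {f : SmoothFun n M} {x : M}
    (hx : x ∉ tsupport f) : act X f x = 0 := by
  have h : (f : M → ℝ) =ᶠ[nhds x] fun _ => 0 := notMem_tsupport_iff_eventuallyEq.mp hx
  have h' : mvfderiv (𝓡 n) f x = mvfderiv (𝓡 n) (fun _ : M => (0 : ℝ)) x := by
    unfold mvfderiv
    ext v
    have e := h.mfderiv_eq (I := 𝓡 n) (I' := 𝓘(ℝ))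
    exact congrArg (fun L : EuclideanSpace ℝ (Fin n) →L[ℝ] ℝ => L v) e
  rw [act_apply, h', mvfderiv_const]
  rfl

end Calculus

/-! ### Evaluation formulas for one-forms. -/

section Tensors

variable {n : ℕ} {M : Type*} [TopologicalSpace M]
  [ChartedSpace (EuclideanSpace ℝ (Fin n)) M] [IsManifold (𝓡 n) ∞ M]

theorem diff_apply (f : SmoothFun n M) (X : VectField n M) : diff f X = act X f := rfl

theorem lieForm_apply (X : VectField n M) (β : OneForm n M) (Y : VectField n M) :
    lieForm X β Y = act X (β Y) - β (lie X Y) := rfl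

theorem transp_apply (J : Tensor11 n M) (α : OneForm n M) (X : VectField n M) :
    transp J α X = α (J X) := rfl

theorem formBracket_apply (Λ : SharpMap n M) (α β : OneForm n M) (X : VectField n M) :
    formBracket Λ α β X =
      act (Λ α) (β X) - β (lie (Λ α) X) - (act (Λ β) (α X) - α (lie (Λ β) X))
        - act X (β (Λ α)) := rfl

theorem lieForm_diff (X : VectField n M) (f : SmoothFun n M) :
    lieForm X (diff f) = diff (act X f) := by
  ext1 Y
  rw [lieForm_apply, diff_apply, diff_apply, diff_apply, act_lie]
  ring

end Tensors

theorem eq_zero_of_add_self {n : ℕ} {M : Type*} [TopologicalSpace M]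
    [ChartedSpace (EuclideanSpace ℝ (Fin n)) M] {f : SmoothFun n M} (h : f + f = 0) : f = 0 := by
  ext x
  have : f x + f x = 0 := DFunLike.congr_fun h x
  exact self_eq_neg.mp (eq_neg_of_add_eq_zero_left this)

theorem smul_eq_algebraMap_mul {n : ℕ} {M : Type*} [TopologicalSpace M]
    [ChartedSpace (EuclideanSpace ℝ (Fin n)) M] (c : ℝ) (f : SmoothFun n M) :
    c • f = algebraMap ℝ (SmoothFun n M) c * f :=
  Algebra.smul_def c f

/-! ### Moving `J` through Lie, form and Schouten brackets. -/

section Concomitant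

variable {n : ℕ} {M : Type*} [TopologicalSpace M]
  [ChartedSpace (EuclideanSpace ℝ (Fin n)) M] [IsManifold (𝓡 n) ∞ M]

theorem lie_map_map {J : Tensor11 n M} {X Y : VectField n M} (h : torsion J X Y = 0) :
    lie (J X) (J Y) = J (lie (J X) Y) + J (lie X (J Y)) - J (J (lie X Y)) := by
  rw [← sub_eq_zero, ← h, torsion]
  abel

/-- Zero torsion means `L_{JX} J = J ∘ L_X J`; this is its iterate `L_{J^j X} J = J^j ∘ L_X J`. -/
theorem IsNijenhuis.lie_pow {J : Tensor11 n M} (hJ : IsNijenhuis J) (j : ℕ)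
    (X Y : VectField n M) :
    lie ((J ^ j) X) (J Y) - J (lie ((J ^ j) X) Y) =
      (J ^ j) (lie X (J Y)) - (J ^ j) (J (lie X Y)) := by
  induction j with
  | zero => rfl
  | succ j ih =>
    have h := congrArg J ih
    simp only [map_sub] at h
    simp only [pow_succ', Module.End.mul_apply]
    rw [← h, lie_map_map (hJ _ _)]
    abel

theorem IsNijenhuis.lie_pow_pow {J : Tensor11 n M} (hJ : IsNijenhuis J) (j m : ℕ)
    (X Y : VectField n M) :
    lie ((J ^ j) X) ((J ^ m) Y) - (J ^ m) (lie ((J ^ j) X) Y) =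
      (J ^ j) (lie X ((J ^ m) Y)) - (J ^ j) ((J ^ m) (lie X Y)) := by
  induction m generalizing Y with
  | zero => simp
  | succ m ih =>
    have h₁ := ih (J Y)
    have h₂ := congrArg (J ^ m) (hJ.lie_pow j X Y)
    simp only [map_sub] at h₂
    have hc (Z : VectField n M) : (J ^ m) ((J ^ j) Z) = (J ^ j) ((J ^ m) Z) := by
      rw [← Module.End.mul_apply, ← Module.End.mul_apply, pow_mul_comm]
    simp only [hc] at h₂
    simp only [pow_succ, Module.End.mul_apply] at h₁ ⊢
    rw [← sub_add_sub_cancel, h₁, h₂]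
    abel

/-- This form isolates `L_{Λα} J` and `L_{Λβ} J`, to which `IsNijenhuis.lie_pow` applies. -/
theorem concomitant_apply {Λ : SharpMap n M} {J : Tensor11 n M}
    (h : J ∘ₗ Λ = Λ ∘ₗ transp J) (α β : OneForm n M) (X : VectField n M) :
    concomitant Λ J α β X =
      act X (β (J (Λ α))) - act (J X) (β (Λ α))
        - β (lie (Λ α) (J X) - J (lie (Λ α) X)) + α (lie (Λ β) (J X) - J (lie (Λ β) X)) := by
  have hc (γ : OneForm n M) : Λ (transp J γ) = J (Λ γ) := (LinearMap.congr_fun h γ).symm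
  have e : concomitant Λ J α β X =
      formBracket (J ∘ₗ Λ) α β X - (formBracket Λ (transp J α) β X
        + formBracket Λ α (transp J β) X - formBracket Λ α β (J X)) := rfl
  rw [e]
  simp only [formBracket_apply, hc, LinearMap.comp_apply, transp_apply, map_sub]
  ring

theorem comp_pow_comm {Λ : SharpMap n M} {J : Tensor11 n M}
    (h : J ∘ₗ Λ = Λ ∘ₗ transp J) (k : ℕ) (α : OneForm n M) :
    Λ (transp (J ^ k) α) = (J ^ k) (Λ α) := by
  induction k generalizing α with
  | zero => rfl
  | succ k ih =>
    have e : transp (J ^ (k + 1)) α = transp (J ^ k) (transp J α) := by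
      ext1 X
      simp only [transp_apply, pow_succ', Module.End.mul_apply]
    have hc : Λ (transp J α) = J (Λ α) := (LinearMap.congr_fun h α).symm
    rw [e, ih, hc, pow_succ, Module.End.mul_apply]

theorem pow_comp_comm {Λ : SharpMap n M} {J : Tensor11 n M}
    (h : J ∘ₗ Λ = Λ ∘ₗ transp J) (k : ℕ) :
    J ∘ₗ ((J ^ k) ∘ₗ Λ) = ((J ^ k) ∘ₗ Λ) ∘ₗ transp J := by
  rw [LinearMap.comp_assoc, ← h, ← LinearMap.comp_assoc, ← LinearMap.comp_assoc]
  exact congrArg (· ∘ₗ Λ) (pow_mul_comm' J k).symm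

/-- In `L_{J^k Λα} J = J^k ∘ L_{Λα} J` the power passes to `β` by transposition, while `J^k Λβ =
Λ(ᵗJ^k β)`. -/
theorem concomitant_pow {Λ : SharpMap n M} {J : Tensor11 n M} (hJ : IsNijenhuis J)
    (h : J ∘ₗ Λ = Λ ∘ₗ transp J) (k : ℕ) (α β : OneForm n M) :
    concomitant ((J ^ k) ∘ₗ Λ) J α β = concomitant Λ J α (transp (J ^ k) β) := by
  ext1 X
  have hJk : (J ^ k) (J (Λ α)) = J ((J ^ k) (Λ α)) := by
    rw [← Module.End.mul_apply, ← Module.End.mul_apply, pow_mul_comm']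
  rw [concomitant_apply (pow_comp_comm h k), concomitant_apply h]
  simp only [LinearMap.comp_apply, transp_apply, comp_pow_comm h k, hJ.lie_pow, map_sub, hJk]

theorem formBracket_comp (Λ : SharpMap n M) (J : Tensor11 n M) (α β : OneForm n M) :
    formBracket (J ∘ₗ Λ) α β =
      formBracket Λ (transp J α) β + formBracket Λ α (transp J β)
        - transp J (formBracket Λ α β) + concomitant Λ J α β := by
  rw [concomitant]
  abel

/-- Zero torsion splits `[JPα, JQβ]` into three brackets, and `formBracket_comp` splits the form
brackets in the same pattern, up to concomitants. -/
theorem schouten_comp_comp {P Q : SharpMap n M} {J : Tensor11 n M} (hJ : IsNijenhuis J)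
    (hP : J ∘ₗ P = P ∘ₗ transp J) (hQ : J ∘ₗ Q = Q ∘ₗ transp J) (α β γ : OneForm n M) :
    schouten (J ∘ₗ P) (J ∘ₗ Q) α β γ =
      schouten P Q (transp J α) β (transp J γ) + schouten P Q α (transp J β) (transp J γ)
        - schouten P Q α β (transp J (transp J γ))
        + γ (J (P (concomitant Q J α β))) + γ (J (Q (concomitant P J α β))) := by
  have hP' (γ : OneForm n M) : P (transp J γ) = J (P γ) := (LinearMap.congr_fun hP γ).symm
  have hQ' (γ : OneForm n M) : Q (transp J γ) = J (Q γ) := (LinearMap.congr_fun hQ γ).symm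
  simp only [schouten, formBracket_comp, LinearMap.comp_apply, transp_apply, map_add, map_sub,
    hP', hQ', lie_map_map (hJ _ _)]
  ring

/-- The `ᵗJ{α, β}` terms of one summand cancel the leading terms of the other, so the torsion does
not enter. -/
theorem schouten_comp_add (P Q : SharpMap n M) {J : Tensor11 n M}
    (hP : J ∘ₗ P = P ∘ₗ transp J) (hQ : J ∘ₗ Q = Q ∘ₗ transp J) (α β γ : OneForm n M) :
    schouten (J ∘ₗ P) Q α β γ + schouten P (J ∘ₗ Q) α β γ =
      schouten P Q (transp J α) β γ + schouten P Q α (transp J β) γ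
        + γ (P (concomitant Q J α β)) + γ (Q (concomitant P J α β)) := by
  have hP' (γ : OneForm n M) : P (transp J γ) = J (P γ) := (LinearMap.congr_fun hP γ).symm
  have hQ' (γ : OneForm n M) : Q (transp J γ) = J (Q γ) := (LinearMap.congr_fun hQ γ).symm
  simp only [schouten, formBracket_comp, LinearMap.comp_apply, map_add, map_sub,
    hP', hQ']
  ring

theorem schouten_comm (P Q : SharpMap n M) (α β γ : OneForm n M) :
    schouten P Q α β γ = schouten Q P α β γ := by
  simp only [schouten, map_add, map_sub]
  ring

theorem lieBivector_eq (X : VectField n M) (Λ : SharpMap n M) (α β : OneForm n M) :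
    lieBivector X Λ α β = β (lie X (Λ α)) - β (Λ (lieForm X α)) := by
  simp only [lieBivector, pair, lieForm_apply]
  ring

end Concomitant

/-! ### The hierarchy `(J^k Λ, J^k E)`. -/

section Hierarchy

variable {n : ℕ} {M : Type*} [TopologicalSpace M]
  [ChartedSpace (EuclideanSpace ℝ (Fin n)) M] [IsManifold (𝓡 n) ∞ M]
  {Λ : SharpMap n M} {E : VectField n M} {J : Tensor11 n M}

theorem IsBivector.pow_comp (hΛ : IsBivector Λ) (h : J ∘ₗ Λ = Λ ∘ₗ transp J) (k : ℕ) :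
    IsBivector ((J ^ k) ∘ₗ Λ) := by
  intro α β
  have := hΛ (transp (J ^ k) α) β
  rwa [comp_pow_comm h] at this

theorem lieBivector_pow (hJ : IsNijenhuis J) (j k : ℕ) (α β : OneForm n M) :
    lieBivector ((J ^ j) E) ((J ^ k) ∘ₗ Λ) α β =
      lieBivector E ((J ^ k) ∘ₗ Λ) α (transp (J ^ j) β)
        - lieBivector E Λ α (transp (J ^ j) (transp (J ^ k) β))
        + lieBivector ((J ^ j) E) Λ α (transp (J ^ k) β) := by
  have hc (Z : VectField n M) : (J ^ j) ((J ^ k) Z) = (J ^ k) ((J ^ j) Z) := by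
    rw [← Module.End.mul_apply, ← Module.End.mul_apply, pow_mul_comm]
  have h := congrArg β (hJ.lie_pow_pow j k E (Λ α))
  simp only [map_sub] at h
  simp only [lieBivector_eq, LinearMap.comp_apply, transp_apply, hc] at h ⊢
  linear_combination h

/-- After `lieBivector_pow`, the symmetric sum regroups into condition (iii) for `j` and for `k`,
and two copies of `[E, Λ] = 0`. -/
theorem lieBivector_pow_add (hΛE : IsJacobiStructure Λ E) (hJ : IsNijenhuis J)
    (hcomp : IsCompatible Λ E J) {j k : ℕ} (hj : 1 ≤ j) (hk : 1 ≤ k) (α β : OneForm n M) :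
    lieBivector ((J ^ j) E) ((J ^ k) ∘ₗ Λ) α β + lieBivector ((J ^ k) E) ((J ^ j) ∘ₗ Λ) α β = 0 := by
  rw [lieBivector_pow hJ, lieBivector_pow hJ]
  linear_combination hcomp.lie_eq j hj α (transp (J ^ k) β)
    + hcomp.lie_eq k hk α (transp (J ^ j) β)
    - hΛE.lie_eq_zero α (transp (J ^ j) (transp (J ^ k) β))
    - hΛE.lie_eq_zero α (transp (J ^ k) (transp (J ^ j) β))

theorem comp_pow_comp (k : ℕ) : J ∘ₗ ((J ^ k) ∘ₗ Λ) = (J ^ (k + 1)) ∘ₗ Λ := by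
  rw [pow_succ']
  rfl

theorem pow_apply_succ (k : ℕ) (X : VectField n M) : J ((J ^ k) X) = (J ^ (k + 1)) X := by
  rw [pow_succ']
  rfl

theorem pair_transp_left (h : J ∘ₗ Λ = Λ ∘ₗ transp J) (k : ℕ) (α β : OneForm n M) :
    pair ((J ^ k) ∘ₗ Λ) (transp J α) β = pair ((J ^ (k + 1)) ∘ₗ Λ) α β := by
  rw [← comp_pow_comp, pow_comp_comm h]
  rfl

theorem pair_transp_right (k : ℕ) (α β : OneForm n M) :
    pair ((J ^ k) ∘ₗ Λ) α (transp J β) = pair ((J ^ (k + 1)) ∘ₗ Λ) α β := by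
  rw [← comp_pow_comp]
  rfl

theorem transp_pow_apply (k : ℕ) (α : OneForm n M) :
    transp J α ((J ^ k) E) = α ((J ^ (k + 1)) E) := by
  rw [transp_apply, pow_apply_succ]

/-- Condition (ii) at `ᵗJ^k β` and `ᵗJ^j γ` evaluates every error term of the induction. -/
theorem apply_concomitant_pow (hJ : IsNijenhuis J) (hcomp : IsCompatible Λ E J) (j k : ℕ)
    (α β γ : OneForm n M) :
    transp J γ (((J ^ j) ∘ₗ Λ) (concomitant ((J ^ k) ∘ₗ Λ) J α β)) =
      pair ((J ^ k) ∘ₗ Λ) α β * γ ((J ^ (j + 2)) E)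
        - pair ((J ^ (k + 1)) ∘ₗ Λ) α β * γ ((J ^ (j + 1)) E) := by
  have h := hcomp.concomitant_eq α (transp (J ^ k) β) (transp (J ^ j) γ)
  have e (X : VectField n M) : transp J (transp (J ^ j) γ) X = γ ((J ^ (j + 1)) X) := by
    simp only [transp_apply, pow_succ, Module.End.mul_apply]
  have e' (X : VectField n M) : transp J γ ((J ^ j) X) = γ ((J ^ (j + 1)) X) := by
    rw [transp_apply, pow_apply_succ]
  have p₁ : pair Λ α (transp (J ^ k) β) = pair ((J ^ k) ∘ₗ Λ) α β := rfl
  have p₂ : pair Λ α (transp J (transp (J ^ k) β)) = pair ((J ^ (k + 1)) ∘ₗ Λ) α β := by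
    rw [pow_succ]
    rfl
  have p₃ : (J ^ (j + 1)) (J E) = (J ^ (j + 2)) E := by
    rw [← Module.End.mul_apply, ← pow_succ]
  rw [concomitant_pow hJ hcomp.comm, LinearMap.comp_apply, e']
  simp only [e, map_add, map_sub, map_smul, smul_eq_mul, p₁, p₂, p₃] at h
  linear_combination h

/-- The value `[J^j Λ, J^k Λ] = J^j E ∧ J^k Λ + J^k E ∧ J^j Λ`, contracted with `ᵗJ γ`. -/
def HierarchyRelation (Λ : SharpMap n M) (E : VectField n M) (J : Tensor11 n M) (j k : ℕ) : Prop :=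
  ∀ α β γ : OneForm n M,
    schouten ((J ^ j) ∘ₗ Λ) ((J ^ k) ∘ₗ Λ) α β (transp J γ) =
      wedge ((J ^ j) E) ((J ^ k) ∘ₗ Λ) α β (transp J γ)
        + wedge ((J ^ k) E) ((J ^ j) ∘ₗ Λ) α β (transp J γ)

theorem HierarchyRelation.schouten_succ (hJ : IsNijenhuis J) (hcomp : IsCompatible Λ E J)
    {j k : ℕ} (H : HierarchyRelation Λ E J j k) (α β γ : OneForm n M) :
    schouten ((J ^ (j + 1)) ∘ₗ Λ) ((J ^ (k + 1)) ∘ₗ Λ) α β γ =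
      wedge ((J ^ (j + 1)) E) ((J ^ (k + 1)) ∘ₗ Λ) α β γ
        + wedge ((J ^ (k + 1)) E) ((J ^ (j + 1)) ∘ₗ Λ) α β γ := by
  have h := hcomp.comm
  have h₁ := apply_concomitant_pow hJ hcomp j k α β γ
  have h₂ := apply_concomitant_pow hJ hcomp k j α β γ
  rw [transp_apply] at h₁ h₂
  rw [← comp_pow_comp j, ← comp_pow_comp k,
    schouten_comp_comp hJ (pow_comp_comm h j) (pow_comp_comm h k), H, H, H, h₁, h₂,
    comp_pow_comp, comp_pow_comp]
  simp only [wedge, pair_transp_left h, pair_transp_right, transp_pow_apply]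
  ring

theorem HierarchyRelation.add_succ (hJ : IsNijenhuis J) (hcomp : IsCompatible Λ E J)
    {j k : ℕ} (H : HierarchyRelation Λ E J j k) (α β γ : OneForm n M) :
    schouten ((J ^ (j + 1)) ∘ₗ Λ) ((J ^ k) ∘ₗ Λ) α β (transp J γ)
        + schouten ((J ^ j) ∘ₗ Λ) ((J ^ (k + 1)) ∘ₗ Λ) α β (transp J γ) =
      wedge ((J ^ (j + 1)) E) ((J ^ k) ∘ₗ Λ) α β (transp J γ)
        + wedge ((J ^ k) E) ((J ^ (j + 1)) ∘ₗ Λ) α β (transp J γ)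
        + (wedge ((J ^ j) E) ((J ^ (k + 1)) ∘ₗ Λ) α β (transp J γ)
        + wedge ((J ^ (k + 1)) E) ((J ^ j) ∘ₗ Λ) α β (transp J γ)) := by
  have h := hcomp.comm
  rw [← comp_pow_comp j, ← comp_pow_comp k,
    schouten_comp_add _ _ (pow_comp_comm h j) (pow_comp_comm h k), H, H,
    apply_concomitant_pow hJ hcomp, apply_concomitant_pow hJ hcomp,
    comp_pow_comp, comp_pow_comp]
  simp only [wedge, pair_transp_left h, pair_transp_right, transp_pow_apply]
  ring

theorem HierarchyRelation.symm {j k : ℕ} (H : HierarchyRelation Λ E J j k) :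
    HierarchyRelation Λ E J k j := fun α β γ => by
  rw [schouten_comm, H, add_comm]

theorem hierarchyRelation_zero (hΛE : IsJacobiStructure Λ E) (hJ : IsNijenhuis J)
    (hcomp : IsCompatible Λ E J) (k : ℕ) : HierarchyRelation Λ E J 0 k := by
  induction k using Nat.strong_induction_on with
  | _ k ih =>
    match k with
    | 0 =>
      intro α β γ
      have h := hΛE.schouten_eq α β (transp J γ)
      rw [two_mul] at h
      exact h
    | 1 =>
      intro α β γ
      have h := (ih 0 Nat.zero_lt_one).add_succ hJ hcomp α β γ
      rw [schouten_comm, zero_add] at h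
      -- By symmetry of the bracket, raising either index of `(0, 0)` gives the same term, so `h` is
      -- twice the goal.
      refine sub_eq_zero.mp (eq_zero_of_add_self ?_)
      linear_combination h
    | k + 2 =>
      intro α β γ
      have h := (ih (k + 1) (Nat.lt_succ_self _)).add_succ hJ hcomp α β γ
      have h' := (ih k (by omega)).schouten_succ hJ hcomp α β (transp J γ)
      -- `h` is the sum of the relations at `(1, k + 1)` and `(0, k + 2)`; `h'` is the first,
      -- obtained from `(0, k)`.
      linear_combination h - h'

/-- Lowering both indices together ends on a pair with a zero index. -/
theorem hierarchyRelation (hΛE : IsJacobiStructure Λ E) (hJ : IsNijenhuis J)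
    (hcomp : IsCompatible Λ E J) (j k : ℕ) : HierarchyRelation Λ E J j k := by
  induction j generalizing k with
  | zero => exact hierarchyRelation_zero hΛE hJ hcomp k
  | succ j ih =>
    match k with
    | 0 => exact (hierarchyRelation_zero hΛE hJ hcomp (j + 1)).symm
    | k + 1 => exact fun α β γ => (ih k).schouten_succ hJ hcomp α β (transp J γ)

theorem schouten_pow_pow (hΛE : IsJacobiStructure Λ E) (hJ : IsNijenhuis J)
    (hcomp : IsCompatible Λ E J) {j k : ℕ} (hj : 1 ≤ j) (hk : 1 ≤ k) (α β γ : OneForm n M) :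
    schouten ((J ^ j) ∘ₗ Λ) ((J ^ k) ∘ₗ Λ) α β γ =
      wedge ((J ^ j) E) ((J ^ k) ∘ₗ Λ) α β γ + wedge ((J ^ k) E) ((J ^ j) ∘ₗ Λ) α β γ := by
  obtain ⟨j, rfl⟩ := Nat.exists_eq_add_of_le' hj
  obtain ⟨k, rfl⟩ := Nat.exists_eq_add_of_le' hk
  exact (hierarchyRelation hΛE hJ hcomp j k).schouten_succ hJ hcomp α β γ

theorem isJacobiStructure_pow (hΛE : IsJacobiStructure Λ E) (hJ : IsNijenhuis J)
    (hcomp : IsCompatible Λ E J) {k : ℕ} (hk : 1 ≤ k) :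
    IsJacobiStructure ((J ^ k) ∘ₗ Λ) ((J ^ k) E) where
  bivector := hΛE.bivector.pow_comp hcomp.comm k
  lie_eq_zero α β := eq_zero_of_add_self (lieBivector_pow_add hΛE hJ hcomp hk hk α β)
  schouten_eq α β γ := by rw [schouten_pow_pow hΛE hJ hcomp hk hk, two_mul]

end Hierarchy

/-! ### A Jacobi structure induces a Jacobi bracket. -/

section JacobiBracket

variable {n : ℕ} {M : Type*} [TopologicalSpace M]
  [ChartedSpace (EuclideanSpace ℝ (Fin n)) M] [IsManifold (𝓡 n) ∞ M]
  {Λ : SharpMap n M} {E : VectField n M}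

theorem jacobiBracket_eq (Λ : SharpMap n M) (E : VectField n M) (f g : SmoothFun n M) :
    jacobiBracket Λ E f g = act (Λ (diff f)) g + (f * act E g - g * act E f) := rfl

theorem IsBivector.act_sharp_diff (hΛ : IsBivector Λ) (f g : SmoothFun n M) :
    act (Λ (diff f)) g = -act (Λ (diff g)) f :=
  eq_neg_of_add_eq_zero_left (hΛ (diff g) (diff f))

theorem IsBivector.formBracket_diff (hΛ : IsBivector Λ) (f g : SmoothFun n M) :
    formBracket Λ (diff f) (diff g) = diff (act (Λ (diff f)) g) := by
  ext1 X
  simp only [formBracket_apply, diff_apply, act_lie]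
  rw [hΛ.act_sharp_diff g f, act_neg]
  ring

theorem schouten_diff (hΛ : IsBivector Λ) (f g h : SmoothFun n M) :
    schouten Λ Λ (diff f) (diff g) (diff h) =
      -2 * (act (Λ (diff f)) (act (Λ (diff g)) h) + act (Λ (diff g)) (act (Λ (diff h)) f)
        + act (Λ (diff h)) (act (Λ (diff f)) g)) := by
  simp only [schouten, hΛ.formBracket_diff, map_add, map_sub, diff_apply, act_lie]
  rw [hΛ.act_sharp_diff (act _ g) h, hΛ.act_sharp_diff h f, act_neg]
  ring

theorem lieBivector_diff (Λ : SharpMap n M) (E : VectField n M) (f g : SmoothFun n M) :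
    lieBivector E Λ (diff f) (diff g) =
      act E (act (Λ (diff f)) g) - act (Λ (diff (act E f))) g - act (Λ (diff f)) (act E g) := by
  simp only [lieBivector, lieForm_diff]
  rfl

theorem IsJacobiStructure.jacobiBracket_jacobi (h : IsJacobiStructure Λ E)
    (f g k : SmoothFun n M) :
    jacobiBracket Λ E f (jacobiBracket Λ E g k) + jacobiBracket Λ E g (jacobiBracket Λ E k f)
      + jacobiBracket Λ E k (jacobiBracket Λ E f g) = 0 := by
  have hs := h.bivector.act_sharp_diff
  have hS := (schouten_diff h.bivector f g k).symm.trans (h.schouten_eq _ _ _)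
  have hL (f g : SmoothFun n M) := (lieBivector_diff Λ E f g).symm.trans (h.lie_eq_zero _ _)
  have h₁ := hL f g
  have h₂ := hL g k
  have h₃ := hL k f
  simp only [wedge, pair, diff_apply] at hS
  rw [hs (act E f) g] at h₁
  rw [hs (act E g) k] at h₂
  rw [hs (act E k) f] at h₃
  -- The goal is doubled to match the factor 2 in `hS`, avoiding division in the function ring.
  refine eq_zero_of_add_self ?_
  simp only [jacobiBracket_eq, act_add, act_sub, act_mul]
  rw [hs g f, hs k g, hs f k]
  linear_combination -hS + 2 * k * h₁ + 2 * f * h₂ + 2 * g * h₃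

theorem IsBivector.jacobiBracket_skew (hΛ : IsBivector Λ) (f g : SmoothFun n M) :
    jacobiBracket Λ E f g = -jacobiBracket Λ E g f := by
  rw [jacobiBracket_eq, jacobiBracket_eq, hΛ.act_sharp_diff]
  ring

theorem jacobiBracket_apply_eq_zero {f g : SmoothFun n M} {x : M} (hx : x ∉ tsupport g) :
    jacobiBracket Λ E f g x = 0 := by
  have h : jacobiBracket Λ E f g x =
      act (Λ (diff f)) g x + (f x * act E g x - g x * act E f x) := rfl
  rw [h, act_apply_eq_zero hx, act_apply_eq_zero hx, image_eq_zero_of_notMem_tsupport hx]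
  ring

theorem tsupport_jacobiBracket_subset (f g : SmoothFun n M) :
    tsupport (jacobiBracket Λ E f g) ⊆ tsupport g := by
  refine closure_minimal (fun x hx => ?_) (isClosed_tsupport _)
  by_contra hx'
  exact hx (jacobiBracket_apply_eq_zero hx')

theorem IsJacobiStructure.isJacobiBracket (h : IsJacobiStructure Λ E) :
    IsJacobiBracket (jacobiBracket Λ E) where
  add_left f g k := by
    rw [h.bivector.jacobiBracket_skew, h.bivector.jacobiBracket_skew f,
      h.bivector.jacobiBracket_skew g]
    simp only [jacobiBracket_eq, act_add]
    ring
  smul_left c f g := by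
    rw [h.bivector.jacobiBracket_skew, h.bivector.jacobiBracket_skew f]
    simp only [jacobiBracket_eq, smul_eq_algebraMap_mul, act_mul, act_algebraMap]
    ring
  skew := h.bivector.jacobiBracket_skew
  jacobi := h.jacobiBracket_jacobi
  isLocal f g := by
    refine Set.subset_inter ?_ (tsupport_jacobiBracket_subset f g)
    have e : (jacobiBracket Λ E f g : M → ℝ) = -jacobiBracket Λ E g f :=
      congrArg DFunLike.coe (h.bivector.jacobiBracket_skew f g)
    have e' : tsupport (jacobiBracket Λ E f g) = tsupport (jacobiBracket Λ E g f) := by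
      rw [e, tsupport, tsupport, Function.support_neg]
    rw [e']
    exact tsupport_jacobiBracket_subset g f

end JacobiBracket

/-! ### Linear combinations of two Jacobi structures. -/

section Pencil

variable {n : ℕ} {M : Type*} [TopologicalSpace M]
  [ChartedSpace (EuclideanSpace ℝ (Fin n)) M] [IsManifold (𝓡 n) ∞ M]
  {P Q : SharpMap n M} {E F : VectField n M}

theorem formBracket_sub_smul (P Q : SharpMap n M) {c : SmoothFun n M}
    (hc : ∀ X : VectField n M, act X c = 0) (α β : OneForm n M) :
    formBracket (P - c • Q) α β = formBracket P α β - c • formBracket Q α β := by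
  ext1 X
  have e : (formBracket P α β - c • formBracket Q α β) X =
      formBracket P α β X - c * formBracket Q α β X := rfl
  rw [e]
  simp only [formBracket_apply, LinearMap.sub_apply, LinearMap.smul_apply, map_sub, map_smul,
    smul_eq_mul, sub_act, smul_act, act_sub, act_mul, sub_lie, smul_lie, hc, zero_smul, sub_zero]
  ring

theorem schouten_sub_smul (P Q : SharpMap n M) {c : SmoothFun n M}
    (hc : ∀ X : VectField n M, act X c = 0) (α β γ : OneForm n M) :
    schouten (P - c • Q) (P - c • Q) α β γ =
      schouten P P α β γ - 2 * c * schouten P Q α β γ + c * c * schouten Q Q α β γ := by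
  simp only [schouten, formBracket_sub_smul P Q hc, LinearMap.sub_apply, LinearMap.smul_apply,
    map_add, map_sub, map_smul, smul_eq_mul, sub_lie, lie_sub, smul_lie, lie_smul, hc,
    zero_smul, sub_zero, zero_add, mul_sub, mul_add]
  ring

theorem lieBivector_sub_smul (P Q : SharpMap n M) (E F : VectField n M) {c : SmoothFun n M}
    (hc : ∀ X : VectField n M, act X c = 0) (α β : OneForm n M) :
    lieBivector (E - c • F) (P - c • Q) α β =
      lieBivector E P α β - c * (lieBivector E Q α β + lieBivector F P α β)
        + c * c * lieBivector F Q α β := by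
  have e : lieForm (E - c • F) α = lieForm E α - c • lieForm F α := by
    ext1 X
    have e : (lieForm E α - c • lieForm F α) X = lieForm E α X - c * lieForm F α X := rfl
    rw [e]
    simp only [lieForm_apply, map_sub, map_smul, smul_eq_mul, sub_act, smul_act, sub_lie,
      smul_lie, hc, zero_smul, sub_zero]
    ring
  simp only [lieBivector_eq, e, LinearMap.sub_apply, LinearMap.smul_apply, map_sub, map_smul,
    smul_eq_mul, sub_lie, lie_sub, smul_lie, lie_smul, hc, zero_smul, sub_zero, zero_add, mul_sub]
  ring

/-- Both structure equations are quadratic in the pair: the coefficients of `1` and `c²` are `hP`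
and `hQ`, that of `c` is `hl` or `hs`. The condition `hc` lets `c` pass through all derivatives like
a scalar. -/
theorem IsJacobiStructure.sub_smul (hP : IsJacobiStructure P E) (hQ : IsJacobiStructure Q F)
    (hl : ∀ α β : OneForm n M, lieBivector E Q α β + lieBivector F P α β = 0)
    (hs : ∀ α β γ : OneForm n M, schouten P Q α β γ = wedge E Q α β γ + wedge F P α β γ)
    {c : SmoothFun n M} (hc : ∀ X : VectField n M, act X c = 0) :
    IsJacobiStructure (P - c • Q) (E - c • F) where
  bivector α β := by
    simp only [LinearMap.sub_apply, LinearMap.smul_apply, map_sub, map_smul, smul_eq_mul]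
    linear_combination hP.bivector α β - c * hQ.bivector α β
  lie_eq_zero α β := by
    rw [lieBivector_sub_smul P Q E F hc, hl, hP.lie_eq_zero, hQ.lie_eq_zero]
    ring
  schouten_eq α β γ := by
    rw [schouten_sub_smul P Q hc, hs, hP.schouten_eq, hQ.schouten_eq]
    simp only [wedge, pair, LinearMap.sub_apply, LinearMap.smul_apply, map_sub, map_smul,
      smul_eq_mul]
    ring

theorem isJacobiPencil_of_schouten_eq (hP : IsJacobiStructure P E) (hQ : IsJacobiStructure Q F)
    (hl : ∀ α β : OneForm n M, lieBivector E Q α β + lieBivector F P α β = 0)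
    (hs : ∀ α β γ : OneForm n M, schouten P Q α β γ = wedge E Q α β γ + wedge F P α β γ) :
    IsJacobiPencil P E Q F where
  jacobi_fst := hP
  jacobi_snd := hQ
  pencil c := by
    have h := (hP.sub_smul hQ hl hs
      (fun X => act_algebraMap X c)).isJacobiBracket
    -- The bracket of a pair is linear in the pair, so the pencil is the bracket of the difference.
    convert h using 3 with f g
    simp only [jacobiBracket_eq, smul_eq_algebraMap_mul, LinearMap.sub_apply,
      LinearMap.smul_apply, sub_act, smul_act]
    ring

end Pencil

end

end JacobiGeometry

theorem mainTheorem1 {n : ℕ} {M : Type*} [TopologicalSpace M] [T2Space M]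
    [ChartedSpace (EuclideanSpace ℝ (Fin n)) M] [IsManifold (𝓡 n) ∞ M]
    (Λ : JacobiGeometry.SharpMap n M) (E : JacobiGeometry.VectField n M)
    (J : JacobiGeometry.Tensor11 n M)
    (hΛE : JacobiGeometry.IsJacobiStructure Λ E)
    (hJ : JacobiGeometry.IsNijenhuis J)
    (hcomp : JacobiGeometry.IsCompatible Λ E J) :
    (∀ k : ℕ, 1 ≤ k →
      JacobiGeometry.IsJacobiStructure ((J ^ k) ∘ₗ Λ) ((J ^ k) E)) ∧
    (∀ k₁ k₂ : ℕ, 1 ≤ k₁ → 1 ≤ k₂ →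
      JacobiGeometry.IsJacobiPencil ((J ^ k₁) ∘ₗ Λ) ((J ^ k₁) E)
        ((J ^ k₂) ∘ₗ Λ) ((J ^ k₂) E)) :=
  ⟨fun _ hk => JacobiGeometry.isJacobiStructure_pow hΛE hJ hcomp hk,
    fun _ _ h₁ h₂ => JacobiGeometry.isJacobiPencil_of_schouten_eq
      (JacobiGeometry.isJacobiStructure_pow hΛE hJ hcomp h₁)
      (JacobiGeometry.isJacobiStructure_pow hΛE hJ hcomp h₂)
      (JacobiGeometry.lieBivector_pow_add hΛE hJ hcomp h₁ h₂)
      (JacobiGeometry.schouten_pow_pow hΛE hJ hcomp h₁ h₂)⟩
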